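/- Let $m\ge 2$ and $N\ge 1$ be coprime integers and let $T\in \mathrm{SL}(m,\mathbb R)$. Write $|v_1,\dots,v_m|$ for the determinant of the matrix with columns $v_1,\dots,v_m\in\mathbb R^m$. A sequence $\gamma:\mathbb Z\to\mathbb R^m$ is *twisted* (of period $N$, with monodromy $T$) if $\gamma_{n+N}=T\gamma_n$ for all $n$; for fixed $T$ the twisted sequences form a vector space, isomorphic to $(\mathbb R^m)^N$ by $\gamma\mapsto(\gamma_0,\dots,\gamma_{N-1})$. Let $$\mathcal M_N^1=\{\gamma \text{ twisted} : d_n(\gamma):=|\gamma_n,\gamma_{n+1},\dots,\gamma_{n+m-1}|=1\ \text{ for all } n\}$$ be the submanifold of arc length parametrized twisted polygons. Its tangent space at $\gamma$ consists of the twisted sequences $X$ (i.e. $X_{n+N}=TX_n$) along which the derivative of every $d_n$ at $\gamma$ vanishes. For $\gamma\in\mathcal M_N^1$ put $a_n^0=(-1)^{m-1}$ and, for $1\le r\le m-1$, let $a_n^r$ be the determinant obtained from $|\gamma_n,\dots,\gamma_{n+m-1}|$ by replacing the column $\gamma_{n+r}$ by $\gamma_{n+m}$, so that $\gamma_{n+m}=\sum_{r=0}^{m-1}a_n^r\gamma_{n+r}$.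 For tangent vectors $X,Y$ at $\gamma$ let $J_n(X)=(-1)^{m-1}\sum_{\ell=0}^{m-1}a_n^\ell X_{n+\ell}$ and define the 2-form $\omega_1$ on $\mathcal M_N^1$ by $$\begin{aligned}\omega_1(X,Y)(\gamma)=\frac12\sum_{n=1}^N\sum_{r=1}^{m-1}\Big(&|J_n(Y),\gamma_{n+1},\dots,X_{n+r},\dots,\gamma_{n+m-1}|-|J_n(X),\gamma_{n+1},\dots,Y_{n+r},\dots,\gamma_{n+m-1}|\\&-|\gamma_n,\dots,X_{n+r-1},\dots,\gamma_{n+m-2},Y_{n+m-1}|+|\gamma_n,\dots,Y_{n+r-1},\dots,\gamma_{n+m-2},X_{n+m-1}|\Big),\end{aligned}$$ where in the first two determinants the vector $X_{n+r}$ (resp. $Y_{n+r}$) replaces the column $\gamma_{n+r}$, and in the last two $X_{n+r-1}$ (resp. $Y_{n+r-1}$) replaces the column $\gamma_{n+r-1}$. Then $\omega_1$ is closed on $\mathcal M_N^1$: $\mathrm d\omega_1|_\gamma(X,Y,Z)=0$ for every $\gamma\in\mathcal M_N^1$ and all tangent vectors $X,Y,Z$ of $\mathcal M_N^1$ at $\gamma$.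 Moreover $\omega_1$ is pre-symplectic, i.e. a closed 2-form with non-trivial kernel: at every $\gamma\in\mathcal M_N^1$ there is a tangent vector $X\neq0$ with $\omega_1(X,Y)(\gamma)=0$ for all tangent vectors $Y$ at $\gamma$. -/

import Mathlib

open scoped ContDiff Matrix MatrixGroups

noncomputable section

namespace CentroAffine

/-- The determinant `|v₀, v₁, …, v_{m-1}|` of the first `m` vectors of a list of vectors of `ℝᵐ`,
taken as columns. -/
def vol {m : ℕ} (v : ℕ → Fin m → ℝ) : ℝ :=
  (Matrix.of fun i j : Fin m => v j i).det

/-- `γ : ℤ → ℝᵐ` is twisted, of period `N` and with monodromy `T`: `γ_{n+N} = T γ_n`. -/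
def IsTwisted {m : ℕ} (N : ℕ) (T : SL(m, ℝ)) (γ : ℤ → Fin m → ℝ) : Prop :=
  ∀ n : ℤ, γ (n + N) = T.1 *ᵥ γ n

/-- The centro-affine arc length `d_n = |γ_n, γ_{n+1}, …, γ_{n+m-1}|`. -/
def arcLength {m : ℕ} (γ : ℤ → Fin m → ℝ) (n : ℤ) : ℝ :=
  vol fun j => γ (n + j)

/-- The space of arc length parametrized twisted polygons in `ℝᵐ` of period `N` and monodromy `T`
(`d_n = 1` contains the non-degeneracy `d_n ≠ 0`). -/
def arcLengthPolygons {m : ℕ} (N : ℕ) (T : SL(m, ℝ)) : Set (ℤ → Fin m → ℝ) :=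
  {γ | IsTwisted N T γ ∧ ∀ n : ℤ, arcLength γ n = 1}

/-- The invariants `a_n^r`: `a_n^0 = (-1)^{m-1}`, and for `1 ≤ r ≤ m-1` the determinant
`|γ_n, …, γ_{n+m-1}|` with its column `γ_{n+r}` replaced by `γ_{n+m}`. -/
def invariant {m : ℕ} (γ : ℤ → Fin m → ℝ) (n : ℤ) (r : ℕ) : ℝ :=
  if r = 0 then (-1) ^ (m - 1)
  else vol (Function.update (fun j => γ (n + j)) r (γ (n + m)))

/-- `J_n(X) = (-1)^{m-1} ∑_{ℓ=0}^{m-1} a_n^ℓ X_{n+ℓ}`. -/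
def J {m : ℕ} (γ X : ℤ → Fin m → ℝ) (n : ℤ) : Fin m → ℝ :=
  (-1 : ℝ) ^ (m - 1) • ∑ l ∈ Finset.range m, invariant γ n l • X (n + l)

/-- `|γ_n, …, γ_{n+m-1}|` with `γ_{n+p}` replaced by `u` and `γ_{n+q}` replaced by `w`. -/
def vol₂ {m : ℕ} (γ : ℤ → Fin m → ℝ) (n : ℤ) (p : ℕ) (u : Fin m → ℝ) (q : ℕ) (w : Fin m → ℝ) : ℝ :=
  vol (Function.update (Function.update (fun j => γ (n + j)) p u) q w)

/-- The value `ω₁(X, Y)(γ)`. Columns are counted from `0` here, so that "position `r + 1`" of the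
first two determinants is column `r`, and "position `r`" of the last two is column `r - 1`. -/
def omega₁ {m : ℕ} (N : ℕ) (γ X Y : ℤ → Fin m → ℝ) : ℝ :=
  (1 / 2) * ∑ n ∈ Finset.Icc (1 : ℤ) N, ∑ r ∈ Finset.Icc 1 (m - 1),
    (vol₂ γ n 0 (J γ Y n) r (X (n + r))
      - vol₂ γ n 0 (J γ X n) r (Y (n + r))
      - vol₂ γ n (r - 1) (X (n + r - 1)) (m - 1) (Y (n + m - 1))
      + vol₂ γ n (r - 1) (Y (n + r - 1)) (m - 1) (X (n + m - 1)))

/-! ### Coordinates on the twisted polygons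

For fixed `T` a twisted polygon is the same as its vertices `γ_0, …, γ_{N-1}`, so the twisted
sequences form a vector space isomorphic to `(ℝᵐ)ᴺ`, on which calculus is done. -/

/-- The vector space `(ℝᵐ)ᴺ` of the `N` free vertices. -/
abbrev Vertices (m N : ℕ) : Type := Fin N → Fin m → ℝ

/-- The position in `{0, …, N-1}` of the residue of `n` modulo `N`. -/
def residue (N : ℕ) [NeZero N] (n : ℤ) : Fin N :=
  ⟨(n % N).toNat, by
    have hN : (0 : ℤ) < N := by exact_mod_cast NeZero.pos N
    have h1 := Int.emod_nonneg n hN.ne'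
    have h2 := Int.emod_lt_of_pos n hN
    omega⟩

/-- The twisted sequence `γ_{kN+i} = T^k x_i` (`0 ≤ i < N`) with monodromy `T` and
vertices `x`. -/
def polygon {m N : ℕ} [NeZero N] (T : SL(m, ℝ)) (x : Vertices m N) (n : ℤ) : Fin m → ℝ :=
  (T ^ (n / (N : ℤ))).1 *ᵥ x (residue N n)

theorem isTwisted_polygon {m N : ℕ} [NeZero N] (T : SL(m, ℝ)) (x : Vertices m N) :
    IsTwisted N T (polygon T x) := by
  intro n
  have hN : (N : ℤ) ≠ 0 := by exact_mod_cast NeZero.ne N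
  have h1 : residue N (n + N) = residue N n := by simp [residue]
  have h2 : (n + N) / (N : ℤ) = 1 + n / N := by
    rw [Int.add_ediv_of_dvd_right (dvd_refl _), Int.ediv_self hN, add_comm]
  simp only [polygon, h1, h2, zpow_add, zpow_one, Matrix.SpecialLinearGroup.coe_mul,
    Matrix.mulVec_mulVec]

/-- Conversely, every twisted sequence is the polygon with its vertices `γ_0, …, γ_{N-1}`. -/
theorem IsTwisted.eq_polygon {m N : ℕ} [NeZero N] {T : SL(m, ℝ)} {γ : ℤ → Fin m → ℝ}
    (h : IsTwisted N T γ) : γ = polygon T fun i : Fin N => γ (i : ℕ) := by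
  have hN : (0 : ℤ) < N := by exact_mod_cast NeZero.pos N
  have key : ∀ (k i : ℤ), γ (i + k * N) = (T ^ k).1 *ᵥ γ i := by
    intro k i
    induction k using Int.induction_on with
    | zero => simp
    | succ k ih =>
      have e : i + ((k : ℤ) + 1) * N = (i + k * N) + N := by ring
      rw [e, h, ih, add_comm (k : ℤ) 1, zpow_add, zpow_one, Matrix.SpecialLinearGroup.coe_mul,
        Matrix.mulVec_mulVec]
    | pred k ih =>
      have e : i + (-(k : ℤ)) * N = (i + (-(k : ℤ) - 1) * N) + N := by ring
      rw [e, h] at ih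
      have e2 : (-(k : ℤ) - 1) = -1 + -(k : ℤ) := by ring
      rw [e2] at ih ⊢
      rw [zpow_add, Matrix.SpecialLinearGroup.coe_mul, ← Matrix.mulVec_mulVec, ← ih,
        Matrix.mulVec_mulVec, ← Matrix.SpecialLinearGroup.coe_mul]
      simp
  funext n
  have h1 := key (n / N) (n % N)
  have h0 := Int.emod_nonneg n hN.ne'
  rw [mul_comm, Int.emod_add_mul_ediv] at h1
  rw [h1]
  simp [polygon, residue, Int.toNat_of_nonneg h0]

theorem polygon_add {m N : ℕ} [NeZero N] (T : SL(m, ℝ)) (x y : Vertices m N) (n : ℤ) :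
    polygon T (x + y) n = polygon T x n + polygon T y n := by
  simp [polygon, Matrix.mulVec_add]

theorem polygon_smul {m N : ℕ} [NeZero N] (T : SL(m, ℝ)) (c : ℝ) (x : Vertices m N) (n : ℤ) :
    polygon T (c • x) n = c • polygon T x n := by
  simp [polygon, Matrix.mulVec_smul]

/-- The tangent space at `x` of the level set `{d_n = 1 for all n}`: the vectors along which all
arc lengths `d_n` have derivative zero, i.e. the arc length preserving directions. -/
def tangent {m N : ℕ} [NeZero N] (T : SL(m, ℝ)) (x : Vertices m N) : Set (Vertices m N) :=
  {X | ∀ n : ℤ, fderiv ℝ (fun y : Vertices m N => arcLength (polygon T y) n) x X = 0}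

/-! ### `ω₁` as a smooth differential form -/

theorem vol_update_add {m : ℕ} (v : ℕ → Fin m → ℝ) {p : ℕ} (hp : p < m) (a b : Fin m → ℝ) :
    vol (Function.update v p (a + b)) =
      vol (Function.update v p a) + vol (Function.update v p b) := by
  have e : ∀ c : Fin m → ℝ, (Matrix.of fun i j : Fin m => Function.update v p c j i) =
      (Matrix.of fun i j : Fin m => v j i).updateCol ⟨p, hp⟩ c := by
    intro c
    ext i j
    by_cases h : (j : ℕ) = p
    · have : j = ⟨p, hp⟩ := Fin.ext h
      subst this
      simp
    · have : j ≠ ⟨p, hp⟩ := fun h' => h (congrArg Fin.val h')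
      simp [h, this]
  simp only [vol, e, Matrix.det_updateCol_add]

theorem vol_update_smul {m : ℕ} (v : ℕ → Fin m → ℝ) {p : ℕ} (hp : p < m) (c : ℝ)
    (a : Fin m → ℝ) : vol (Function.update v p (c • a)) = c * vol (Function.update v p a) := by
  have e : ∀ c : Fin m → ℝ, (Matrix.of fun i j : Fin m => Function.update v p c j i) =
      (Matrix.of fun i j : Fin m => v j i).updateCol ⟨p, hp⟩ c := by
    intro c
    ext i j
    by_cases h : (j : ℕ) = p
    · have : j = ⟨p, hp⟩ := Fin.ext h
      subst this
      simp
    · have : j ≠ ⟨p, hp⟩ := fun h' => h (congrArg Fin.val h')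
      simp [h, this]
  simp only [vol, e, Matrix.det_updateCol_smul]

theorem J_add {m : ℕ} (γ X Y : ℤ → Fin m → ℝ) (n : ℤ) :
    J γ (fun k => X k + Y k) n = J γ X n + J γ Y n := by
  simp only [J, smul_add, Finset.sum_add_distrib]

theorem J_smul {m : ℕ} (γ X : ℤ → Fin m → ℝ) (c : ℝ) (n : ℤ) :
    J γ (fun k => c • X k) n = c • J γ X n := by
  simp only [J, Finset.smul_sum]
  refine Finset.sum_congr rfl fun l _ => ?_
  simp only [smul_smul]
  congr 1
  ring

theorem vol₂_add_right {m : ℕ} (γ : ℤ → Fin m → ℝ) (n : ℤ) (p : ℕ) (u : Fin m → ℝ) {q : ℕ}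
    (hq : q < m) (w w' : Fin m → ℝ) :
    vol₂ γ n p u q (w + w') = vol₂ γ n p u q w + vol₂ γ n p u q w' :=
  vol_update_add _ hq _ _

theorem vol₂_smul_right {m : ℕ} (γ : ℤ → Fin m → ℝ) (n : ℤ) (p : ℕ) (u : Fin m → ℝ) {q : ℕ}
    (hq : q < m) (c : ℝ) (w : Fin m → ℝ) :
    vol₂ γ n p u q (c • w) = c * vol₂ γ n p u q w :=
  vol_update_smul _ hq _ _

theorem vol₂_add_left {m : ℕ} (γ : ℤ → Fin m → ℝ) (n : ℤ) {p q : ℕ} (hp : p < m) (hpq : p ≠ q)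
    (u u' w : Fin m → ℝ) :
    vol₂ γ n p (u + u') q w = vol₂ γ n p u q w + vol₂ γ n p u' q w := by
  simp only [vol₂, Function.update_comm hpq]
  exact vol_update_add _ hp _ _

theorem vol₂_smul_left {m : ℕ} (γ : ℤ → Fin m → ℝ) (n : ℤ) {p q : ℕ} (hp : p < m) (hpq : p ≠ q)
    (c : ℝ) (u w : Fin m → ℝ) :
    vol₂ γ n p (c • u) q w = c * vol₂ γ n p u q w := by
  simp only [vol₂, Function.update_comm hpq]
  exact vol_update_smul _ hp _ _

theorem omega₁_swap {m : ℕ} (N : ℕ) (γ X Y : ℤ → Fin m → ℝ) :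
    omega₁ N γ X Y = -omega₁ N γ Y X := by
  unfold omega₁
  rw [← mul_neg, ← Finset.sum_neg_distrib]
  congr 1
  refine Finset.sum_congr rfl fun n _ => ?_
  rw [← Finset.sum_neg_distrib]
  refine Finset.sum_congr rfl fun r _ => ?_
  ring

theorem omega₁_add_left {m : ℕ} (N : ℕ) (γ X X' Y : ℤ → Fin m → ℝ) :
    omega₁ N γ (fun k => X k + X' k) Y = omega₁ N γ X Y + omega₁ N γ X' Y := by
  simp only [omega₁, ← mul_add, ← Finset.sum_add_distrib]
  congr 1
  refine Finset.sum_congr rfl fun n _ => Finset.sum_congr rfl fun r hr => ?_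
  rw [Finset.mem_Icc] at hr
  rw [J_add, vol₂_add_right γ n 0 _ (by omega), vol₂_add_left γ n (by omega) (by omega),
    vol₂_add_left γ n (by omega) (by omega), vol₂_add_right γ n _ _ (by omega)]
  ring

theorem omega₁_smul_left {m : ℕ} (N : ℕ) (γ X Y : ℤ → Fin m → ℝ) (c : ℝ) :
    omega₁ N γ (fun k => c • X k) Y = c * omega₁ N γ X Y := by
  simp only [omega₁]
  rw [mul_left_comm c]
  congr 1
  rw [Finset.mul_sum]
  refine Finset.sum_congr rfl fun n _ => ?_
  rw [Finset.mul_sum]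
  refine Finset.sum_congr rfl fun r hr => ?_
  rw [Finset.mem_Icc] at hr
  rw [J_smul, vol₂_smul_right γ n 0 _ (by omega), vol₂_smul_left γ n (by omega) (by omega),
    vol₂_smul_left γ n (by omega) (by omega), vol₂_smul_right γ n _ _ (by omega)]
  ring

theorem contDiff_vol {E : Type*} [NormedAddCommGroup E] [NormedSpace ℝ E] {m : ℕ}
    {v : E → ℕ → Fin m → ℝ} (hv : ∀ j, ContDiff ℝ ∞ fun x => v x j) :
    ContDiff ℝ ∞ fun x => vol (v x) := by
  simp only [vol, Matrix.det_apply, Matrix.of_apply]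
  refine ContDiff.sum fun σ _ => ContDiff.const_smul _ (contDiff_prod fun i _ => ?_)
  exact contDiff_pi.1 (hv i) _

theorem contDiff_update {E : Type*} [NormedAddCommGroup E] [NormedSpace ℝ E] {m : ℕ}
    {v : E → ℕ → Fin m → ℝ} (hv : ∀ j, ContDiff ℝ ∞ fun x => v x j) (p : ℕ)
    {u : E → Fin m → ℝ} (hu : ContDiff ℝ ∞ u) (j : ℕ) :
    ContDiff ℝ ∞ fun x => Function.update (v x) p (u x) j := by
  by_cases h : j = p
  · subst h
    simpa using hu
  · simpa [h] using hv j

theorem contDiff_omega₁ {E : Type*} [NormedAddCommGroup E] [NormedSpace ℝ E] {m : ℕ} (N : ℕ)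
    {γ X Y : E → ℤ → Fin m → ℝ} (hγ : ∀ n, ContDiff ℝ ∞ fun x => γ x n)
    (hX : ∀ n, ContDiff ℝ ∞ fun x => X x n) (hY : ∀ n, ContDiff ℝ ∞ fun x => Y x n) :
    ContDiff ℝ ∞ fun x => omega₁ N (γ x) (X x) (Y x) := by
  have hJ : ∀ {Z : E → ℤ → Fin m → ℝ}, (∀ n, ContDiff ℝ ∞ fun x => Z x n) → ∀ n,
      ContDiff ℝ ∞ fun x => J (γ x) (Z x) n := by
    intro Z hZ n
    refine ContDiff.const_smul _ (ContDiff.sum fun l _ =>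
      (?_ : ContDiff ℝ ∞ fun x => invariant (γ x) n l).smul (hZ (n + l)))
    by_cases hl : l = 0
    · simpa [invariant, hl] using contDiff_const
    · simpa [invariant, hl] using contDiff_vol (contDiff_update (fun j => hγ _) l (hγ _))
  have h2 : ∀ {u w : E → Fin m → ℝ}, ContDiff ℝ ∞ u → ContDiff ℝ ∞ w → ∀ n p q,
      ContDiff ℝ ∞ fun x => vol₂ (γ x) n p (u x) q (w x) := fun hu hw n p q =>
    contDiff_vol (contDiff_update (contDiff_update (fun j => hγ _) p hu) q hw)
  refine contDiff_const.mul (ContDiff.sum fun n _ => ContDiff.sum fun r _ => ?_)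
  exact (((h2 (hJ hY n) (hX _) _ _ _).sub (h2 (hJ hX n) (hY _) _ _ _)).sub
    (h2 (hX _) (hY _) _ _ _)).add (h2 (hY _) (hX _) _ _ _)

theorem contDiff_polygon {m N : ℕ} [NeZero N] (T : SL(m, ℝ)) (n : ℤ) :
    ContDiff ℝ ∞ fun x : Vertices m N => polygon T x n := by
  have : (fun x : Vertices m N => polygon T x n) =
      ((Matrix.mulVecLin (T ^ (n / (N : ℤ))).1).toContinuousLinearMap ∘L
        ContinuousLinearMap.proj (residue N n) : Vertices m N →L[ℝ] Fin m → ℝ) := by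
    ext x
    simp [polygon]
  rw [this]
  exact ContinuousLinearMap.contDiff _

/-- The form `ω₁` in the coordinates `x = (γ_0, …, γ_{N-1})`, as a differential 2-form given by the
same (polynomial) formula at all points `x` and vectors `X`, `Y` of `(ℝᵐ)ᴺ`; the form on the space
of arc length parametrized polygons is its restriction. -/
def omega₁Form {m N : ℕ} [NeZero N] (T : SL(m, ℝ)) (x : Vertices m N) :
    Vertices m N [⋀^Fin 2]→L[ℝ] ℝ where
  toFun v := omega₁ N (polygon T x) (polygon T (v 0)) (polygon T (v 1))
  map_update_add' v i a b := by
    have hadd : ∀ a b : Vertices m N,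
        polygon T (a + b) = fun n => polygon T a n + polygon T b n :=
      fun a b => funext (polygon_add T a b)
    fin_cases i
    · simp [hadd, omega₁_add_left]
    · simp only [Fin.mk_one, Function.update_self, ne_eq, zero_ne_one, not_false_eq_true,
        Function.update_of_ne, hadd]
      rw [omega₁_swap, omega₁_add_left, omega₁_swap N _ _ (polygon T a),
        omega₁_swap N _ _ (polygon T b)]
      ring
  map_update_smul' v i c a := by
    have hsmul : ∀ a : Vertices m N, polygon T (c • a) = fun n => c • polygon T a n :=
      fun a => funext (polygon_smul T c a)
    fin_cases i
    · simp [hsmul, omega₁_smul_left]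
    · simp only [Fin.mk_one, Function.update_self, ne_eq, zero_ne_one, not_false_eq_true,
        Function.update_of_ne, hsmul, smul_eq_mul]
      rw [omega₁_swap, omega₁_smul_left, omega₁_swap N _ _ (polygon T a)]
      ring
  cont := by
    refine (contDiff_omega₁ (E := Fin 2 → Vertices m N) N (γ := fun _ => polygon T x)
      (X := fun v => polygon T (v 0)) (Y := fun v => polygon T (v 1))
      (fun _ => contDiff_const) (fun n => ?_) (fun n => ?_)).continuous
    · exact (contDiff_polygon T n).comp (contDiff_apply ℝ _ (0 : Fin 2))
    · exact (contDiff_polygon T n).comp (contDiff_apply ℝ _ (1 : Fin 2))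
  map_eq_zero_of_eq' v i j h hij := by
    have h01 : v 0 = v 1 := by
      fin_cases i <;> fin_cases j <;> simp_all
    have := omega₁_swap N (polygon T x) (polygon T (v 1)) (polygon T (v 1))
    simp only [h01]
    linarith

/-- The form is smooth, so its exterior derivative is a genuine one. -/
theorem contDiff_omega₁Form {m N : ℕ} [NeZero N] (T : SL(m, ℝ)) :
    ContDiff ℝ ∞ (omega₁Form T : Vertices m N → Vertices m N [⋀^Fin 2]→L[ℝ] ℝ) := by
  let A := Vertices m N [⋀^Fin 2]→L[ℝ] ℝ
  let b := Module.finBasis ℝ (Vertices m N)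
  let ev : A →ₗ[ℝ] ((Fin 2 → Fin (Module.finrank ℝ (Vertices m N))) → ℝ) :=
    { toFun := fun f k => f fun i => b (k i)
      map_add' := fun _ _ => rfl
      map_smul' := fun _ _ => rfl }
  have hinj : ev.ker = ⊥ := by
    rw [LinearMap.ker_eq_bot]
    intro f g hfg
    have : f.toAlternatingMap = g.toAlternatingMap :=
      b.ext_alternating fun k _ => congrFun hfg k
    ext v
    exact DFunLike.congr_fun this v
  obtain ⟨g, hg⟩ := ev.exists_leftInverse_of_injective hinj
  have hfac : (omega₁Form T : Vertices m N → A) = fun x => g (ev (omega₁Form T x)) := by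
    funext x
    exact (DFunLike.congr_fun hg (omega₁Form T x)).symm
  rw [hfac]
  refine (LinearMap.toContinuousLinearMap g).contDiff.comp (contDiff_pi.2 fun k => ?_)
  exact contDiff_omega₁ N (contDiff_polygon T) (fun _ => contDiff_const) (fun _ => contDiff_const)

/-- If `N` and `m` are coprime, the differentials of `d_0, …, d_{N-1}` are linearly independent at
each point of the level set, which is therefore a smooth submanifold with tangent space
`tangent T x`. -/
theorem surjective_fderiv_arcLength {m N : ℕ} [NeZero N] (hm : 2 ≤ m) (hNm : Nat.Coprime N m)
    (T : SL(m, ℝ)) (x : Vertices m N) (hx : polygon T x ∈ arcLengthPolygons N T) :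
    Function.Surjective fun (X : Vertices m N) (n : Fin N) =>
      fderiv ℝ (fun y : Vertices m N => arcLength (polygon T y) (n : ℕ)) x X := by
  have hN : (0 : ℤ) < N := by exact_mod_cast NeZero.pos N
  -- the derivative along `X_i = s_i x_i`
  have hder : ∀ (s : Fin N → ℝ) (n : ℤ),
      fderiv ℝ (fun y : Vertices m N => arcLength (polygon T y) n) x (fun i => s i • x i) =
        ∑ j : Fin m, s (residue N (n + (j : ℕ))) := by
    intro s n
    have hd : DifferentiableAt ℝ (fun y : Vertices m N => arcLength (polygon T y) n) x :=
      (contDiff_vol (fun j => contDiff_polygon T _)).differentiable (by simp) x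
    rw [← hd.lineDeriv_eq_fderiv, lineDeriv]
    have e : (fun t : ℝ => arcLength (polygon T (x + t • fun i => s i • x i)) n) =
        fun t => ∏ j : Fin m, (1 + t * s (residue N (n + (j : ℕ)))) := by
      funext t
      have hu : ∀ k, polygon T (x + t • fun i => s i • x i) k =
          (1 + t * s (residue N k)) • polygon T x k := by
        intro k
        simp [polygon, Matrix.mulVec_add, Matrix.mulVec_smul, add_smul, mul_smul]
      have h1 := hx.2 n
      simp only [arcLength, vol, hu] at h1 ⊢
      have := Matrix.det_mul_row (fun j : Fin m => 1 + t * s (residue N (n + (j : ℕ))))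
        (Matrix.of fun i j : Fin m => polygon T x (n + (j : ℕ)) i)
      rw [h1, mul_one] at this
      simpa using this
    rw [e]
    have hp : HasDerivAt (fun t : ℝ => ∏ j : Fin m, (1 + t * s (residue N (n + (j : ℕ)))))
        (∑ j : Fin m, (∏ i ∈ Finset.univ.erase j, (1 + (0 : ℝ) * s (residue N (n + (i : ℕ))))) •
          s (residue N (n + (j : ℕ)))) 0 :=
      HasDerivAt.fun_finsetProd fun j _ => by
        simpa using ((hasDerivAt_id (0 : ℝ)).mul_const (s (residue N (n + (j : ℕ))))).const_add 1
    rw [hp.deriv]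
    simp
  let R : (Fin N → ℝ) →ₗ[ℝ] (Fin N → ℝ) :=
    { toFun := fun s n => ∑ j : Fin m, s (residue N (((n : ℕ) : ℤ) + (j : ℕ)))
      map_add' := fun s t => by ext n; simp [Finset.sum_add_distrib]
      map_smul' := fun c s => by ext n; simp [Finset.mul_sum] }
  have hRinj : Function.Injective R := by
    rw [injective_iff_map_eq_zero]
    intro s hs
    let f : ℤ → ℝ := fun n => s (residue N n)
    have hper : ∀ n, f (n + N) = f n := by
      intro n
      simp [f, residue]
    have hperk : Function.Periodic f (N : ℤ) := hper
    have hres : ∀ n : ℤ, ((residue N n : ℕ) : ℤ) = n % N := fun n =>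
      Int.toNat_of_nonneg (Int.emod_nonneg n hN.ne')
    have hsum : ∀ n : ℤ, ∑ j ∈ Finset.range m, f (n + (j : ℕ)) = 0 := by
      intro n
      have := congrFun hs (residue N n)
      simp only [R, LinearMap.coe_mk, AddHom.coe_mk, hres] at this
      rw [Finset.sum_range]
      rw [Pi.zero_apply] at this
      rw [← this]
      refine Finset.sum_congr rfl fun j _ => ?_
      simp [f, residue]
    have hperm : Function.Periodic f (m : ℤ) := by
      intro n
      have h1 := hsum n
      have h2 := hsum (n + 1)
      obtain ⟨k, rfl⟩ : ∃ k, m = k + 1 := ⟨m - 1, by omega⟩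
      rw [Finset.sum_range_succ'] at h1
      rw [Finset.sum_range_succ] at h2
      have e1 : ∀ j : ℕ, n + 1 + (j : ℤ) = n + ((j + 1 : ℕ) : ℤ) := fun j => by push_cast; ring
      simp only [e1] at h2
      simp only [Nat.cast_zero, add_zero] at h1
      linarith
    have hone : Function.Periodic f 1 := by
      have hb : (1 : ℤ) = Nat.gcdA N m * N + Nat.gcdB N m * m := by
        have := Nat.gcd_eq_gcd_ab N m
        rw [hNm] at this
        push_cast at this
        linarith
      rw [hb]
      exact (hperk.int_mul _).add_period (hperm.int_mul _)
    have hconst : ∀ n, f n = f 0 := by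
      intro n
      simpa using (hone.int_mul n) 0
    have h0 : f 0 = 0 := by
      have := hsum 0
      simp only [hconst] at this
      simp only [Finset.sum_const, Finset.card_range, nsmul_eq_mul, mul_eq_zero,
        Nat.cast_eq_zero] at this
      rcases this with h | h
      · omega
      · exact h
    funext i
    have hi : residue N ((i : ℕ) : ℤ) = i := by
      apply Fin.ext
      have : (((i : ℕ) : ℤ)) % N = (i : ℕ) :=
        Int.emod_eq_of_lt (by positivity) (by exact_mod_cast i.2)
      simp [residue, this]
    have := hconst ((i : ℕ) : ℤ)
    simp only [f, hi] at this
    rw [this]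
    exact h0
  intro y
  obtain ⟨s, hs⟩ := (LinearMap.injective_iff_surjective.1 hRinj) y
  refine ⟨fun i => s i • x i, ?_⟩
  funext n
  rw [← hs]
  exact hder s _

end CentroAffine

end

/-! On an arc length parametrized polygon each frame `(γ_n, …, γ_{n+m-1})` is a basis, so a tangent
vector `X` determines matrices `A_n(X)` with `A_n(X) γ_{n+j} = X_{n+j}` for `0 ≤ j < m`. Tangency
says that they are traceless, and consecutive ones differ by a rank-one jump
`A_{n+1}(X) = A_n(X) + δ_n(X) c_{n+1}ᵀ`. Here `δ_n(X)` measures the failure of `X` to satisfy the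
recurrence of `γ`, and `c_{n+1}` is the linear form `|γ_{n+1}, …, γ_{n+m-1}, ·|`, which vanishes on
every `δ_n(X)`; hence the product of any two jumps at the same place is zero.

Cancelling a telescoping boundary term leaves
`ω₁(X, Y) = ½ ∑_n (B_n(Y, X) - B_n(X, Y))`, where
`B_n(X, Y) = ∑_r |γ_{n+1}, …, X_{n+r}, …, γ_{n+m-1}, δ_n(Y)|`. A derivative of `B_n` consists of a
second derivative of a determinant, which is symmetric and disappears from `dω₁`, and of a trace
`tr(A_n(Y) A_n(Z) δ_n(X) c_{n+1}ᵀ)`. The alternating sum of these traces is exactly the increment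
from `n` to `n + 1` of `tr(A_n(X) [A_n(Z), A_n(Y)])`. The monodromy acts on `A_n` by conjugation,
so this function of `n` is periodic and the sum over a period vanishes.

For the kernel, let `A ≠ 0` be traceless and commute with `T`. Then `X = A γ` is tangent, satisfies
the recurrence of `γ`, and the `n`-th term of `2 ω₁(X, Y)` is the increment of the periodic function
`tr(A A_n(Y))`.
-/

noncomputable section

namespace CentroAffine

open Finset Function Matrix

section MatrixLemmas

variable {n : Type*} [Fintype n]

theorem exists_ne_zero_trace_eq_zero_commute {K : Type*} [Field K] [Nontrivial n]
    (B : Matrix n n K) : ∃ A : Matrix n n K, A ≠ 0 ∧ A.trace = 0 ∧ Commute A B := by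
  classical
  by_cases hcard : (Fintype.card n : K) = 0
  · exact ⟨1, one_ne_zero, by simp [hcard], Commute.one_left B⟩
  by_cases hB : B = (B.trace / Fintype.card n) • 1
  · obtain ⟨i, j, hij⟩ := exists_pair_ne n
    have hsingle : Matrix.single i j (1 : K) ≠ 0 := fun h => by simpa using congr_fun₂ h i j
    refine ⟨Matrix.single i j 1, hsingle, trace_single_eq_of_ne _ _ _ hij, ?_⟩
    rw [hB]
    exact (Commute.one_right _).smul_right _
  · refine ⟨B - (B.trace / Fintype.card n) • 1, sub_ne_zero.2 hB, ?_, ?_⟩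
    · simp [trace_sub, trace_smul, hcard]
    · exact (Commute.refl B).sub_left ((Commute.one_left B).smul_left _)

theorem trace_eq_of_semiconjBy {R : Type*} [CommRing R] [DecidableEq n] {u x y : Matrix n n R}
    (hu : IsUnit u) (h : SemiconjBy u x y) : y.trace = x.trace := by
  obtain ⟨u, rfl⟩ := hu
  rw [← trace_units_conj u x, h.eq, Units.mul_inv_cancel_right]

variable {R : Type*} [CommRing R]

theorem trace_mul_vecMulVec (A : Matrix n n R) (u c : n → R) :
    (A * vecMulVec u c).trace = c ⬝ᵥ A *ᵥ u := by
  rw [mul_vecMulVec, trace_vecMulVec, dotProduct_comm]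

theorem trace_mul_mul_add_sub_of_mul_eq_zero {x y z a b c : Matrix n n R} (hab : a * b = 0)
    (hbc : b * c = 0) (hca : c * a = 0) :
    ((x + a) * (y + b) * (z + c)).trace - (x * y * z).trace =
      (y * z * a).trace + (z * x * b).trace + (x * y * c).trace := by
  have hxbc : (x * b * c).trace = 0 := by rw [Matrix.mul_assoc, hbc, Matrix.mul_zero, trace_zero]
  have hayc : (a * y * c).trace = 0 := by
    rw [trace_mul_cycle, hca, Matrix.zero_mul, trace_zero]
  simp only [Matrix.add_mul, Matrix.mul_add, trace_add, hab, hxbc, hayc, Matrix.zero_mul,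
    trace_zero, trace_mul_cycle y z a, trace_mul_cycle x b z]
  ring

end MatrixLemmas

theorem sum_Icc_sub_of_periodic {M : Type*} [AddCommGroup M] {f : ℤ → M} {N : ℕ}
    (hf : Periodic f N) : ∑ n ∈ Icc (1 : ℤ) N, (f (n + 1) - f n) = 0 := by
  have htelescope : ∀ k : ℕ, ∑ n ∈ Icc (1 : ℤ) k, (f (n + 1) - f n) = f (k + 1) - f 1 := by
    intro k
    induction k with
    | zero => simp
    | succ k ih =>
      have hIcc : Icc (1 : ℤ) (k + 1 : ℕ) = insert ((k : ℤ) + 1) (Icc (1 : ℤ) k) := by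
        ext x
        simp only [mem_Icc, mem_insert]
        lia
      rw [hIcc, sum_insert (by simp), ih, Nat.cast_add, Nat.cast_one]
      abel
  rw [htelescope, add_comm (N : ℤ) 1, hf, sub_self]

theorem sum_Icc_one_eq_sum_range {M : Type*} [AddCommMonoid M] (f : ℕ → M) (k : ℕ) :
    ∑ r ∈ Icc 1 k, f r = ∑ r ∈ range k, f (r + 1) := by
  rw [range_eq_Ico, sum_Ico_add' f 0 k 1, zero_add, Ico_add_one_right_eq_Icc]

theorem sum_range_eq_sum_range_pred_add {M : Type*} [AddCommMonoid M] (f : ℕ → M) (k : ℕ)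
    [NeZero k] : ∑ r ∈ range k, f r = ∑ r ∈ range (k - 1), f r + f (k - 1) := by
  rw [← sum_range_succ, Nat.sub_add_cancel NeZero.one_le]

section Determinants

variable {m : ℕ}

/-- The matrix whose columns are the first `m` vectors of a list of vectors of `ℝᵐ`, so that
`vol v = (columns v).det`. -/
def columns (v : ℕ → Fin m → ℝ) : Matrix (Fin m) (Fin m) ℝ :=
  Matrix.of fun i j => v j i

theorem columns_update (v : ℕ → Fin m → ℝ) (p : Fin m) (u : Fin m → ℝ) :
    columns (update v p u) = (columns v).updateCol p u := by
  ext i j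
  by_cases h : j = p
  · simp [columns, h]
  · simp [columns, h, Fin.val_ne_of_ne h]

theorem mul_columns (A : Matrix (Fin m) (Fin m) ℝ) (v : ℕ → Fin m → ℝ) :
    A * columns v = columns fun j => A *ᵥ v j := rfl

theorem columns_mulVec (v : ℕ → Fin m → ℝ) (a : Fin m → ℝ) :
    columns v *ᵥ a = ∑ j, a j • v j := by
  ext i
  simp [columns, mulVec, dotProduct, mul_comm]

theorem vol_mulVec (A : Matrix (Fin m) (Fin m) ℝ) (v : ℕ → Fin m → ℝ) :
    vol (fun j => A *ᵥ v j) = A.det * vol v :=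
  det_mul A (columns v)

theorem vol_update (v : ℕ → Fin m → ℝ) (p : Fin m) (u : Fin m → ℝ) :
    vol (update v p u) = ((columns v).adjugate *ᵥ u) p := by
  rw [← cramer_eq_adjugate_mulVec, cramer_apply, ← columns_update]
  rfl

theorem sum_vol_update_smul (v : ℕ → Fin m → ℝ) (u : Fin m → ℝ) :
    ∑ l ∈ range m, vol (update v l u) • v l = vol v • u := by
  simp_rw [sum_range, vol_update, ← columns_mulVec, mulVec_mulVec, mul_adjugate, smul_mulVec,
    one_mulVec]
  rfl

theorem sum_vol_update_mulVec (A : Matrix (Fin m) (Fin m) ℝ) (v : ℕ → Fin m → ℝ) :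
    ∑ l ∈ range m, vol (update v l (A *ᵥ v l)) = A.trace * vol v := by
  calc ∑ l ∈ range m, vol (update v l (A *ᵥ v l))
      = ((columns v).adjugate * (A * columns v)).trace := by
        simp_rw [sum_range, vol_update]
        rfl
    _ = A.trace * vol v := by
        rw [trace_mul_comm, Matrix.mul_assoc, mul_adjugate, Matrix.mul_smul, trace_smul,
          Matrix.mul_one, smul_eq_mul, mul_comm]
        rfl

theorem vol_update_eq_zero (v : ℕ → Fin m → ℝ) {p q : ℕ} (hp : p < m) (hq : q < m)
    (hpq : p ≠ q) : vol (update v p (v q)) = 0 :=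
  det_zero_of_column_eq (i := ⟨p, hp⟩) (j := ⟨q, hq⟩) (by simpa using hpq) fun i => by
    simp [hpq.symm]

theorem vol_rotate [NeZero m] (v : ℕ → Fin m → ℝ) :
    vol (update (fun j => v (j + 1)) (m - 1) (v 0)) = (-1) ^ (m - 1) * vol v := by
  obtain ⟨k, rfl⟩ := Nat.exists_eq_succ_of_ne_zero (NeZero.ne m)
  have hperm : columns (update (fun j => v (j + 1)) k (v 0)) =
      (columns v).submatrix id (finRotate (k + 1)) := by
    ext i j
    induction j using Fin.lastCases with
    | last => simp [columns]
    | cast j => simp [columns, j.2.ne]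
  calc vol (update (fun j => v (j + 1)) k (v 0))
      = ((columns v).submatrix id (finRotate (k + 1))).det := congrArg det hperm
    _ = (-1) ^ k * vol v := by
        rw [det_permute', sign_finRotate]
        simp [vol, columns]

theorem hasDerivAt_vol {v : ℝ → ℕ → Fin m → ℝ} {v' : ℕ → Fin m → ℝ} {t : ℝ}
    (h : ∀ j, HasDerivAt (fun s => v s j) (v' j) t) :
    HasDerivAt (fun s => vol (v s)) (∑ j ∈ range m, vol (update (v t) j (v' j))) t := by
  let D : ContinuousMultilinearMap ℝ (fun _ : Fin m => Fin m → ℝ) ℝ :=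
    { (detRowAlternating (n := Fin m) (R := ℝ)).toMultilinearMap with
      cont := (continuous_id (X := Matrix (Fin m) (Fin m) ℝ)).matrix_det }
  have hD : ∀ w : ℕ → Fin m → ℝ, vol w = D fun j : Fin m => w j := fun w =>
    (det_transpose (columns w)).symm
  have hlist : HasDerivAt (fun s => fun j : Fin m => v s j) (fun j : Fin m => v' j) t :=
    hasDerivAt_pi.2 fun j => h j
  have hsum : ∑ j ∈ range m, vol (update (v t) j (v' j)) =
      D.linearDeriv (fun j : Fin m => v t j) fun j : Fin m => v' j := by
    rw [sum_range, ContinuousMultilinearMap.linearDeriv_apply]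
    refine sum_congr rfl fun j _ => ?_
    rw [hD]
    exact congrArg D (update_comp_eq_of_injective _ Fin.val_injective _ _)
  rw [hsum]
  simp_rw [hD]
  exact (D.hasFDerivAt _).comp_hasDerivAt t hlist

end Determinants

section Frames

variable {m : ℕ}

/-- The frame `F_n` with columns `γ_n, …, γ_{n+m-1}`, whose determinant is `arcLength γ n`. -/
def frame (γ : ℤ → Fin m → ℝ) (n : ℤ) : Matrix (Fin m) (Fin m) ℝ :=
  columns fun j => γ (n + j)

/-- The failure `δ_n(X) = X_{n+m} - ∑_l a_n^l X_{n+l}` of `X` to satisfy the linear recurrence of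
`γ`. -/
def defect (γ X : ℤ → Fin m → ℝ) (n : ℤ) : Fin m → ℝ :=
  X (n + m) - ∑ l ∈ range m, invariant γ n l • X (n + l)

/-- The derivative along `X` of `γ ↦ |γ_n, …, γ_{n+m-2}, u|`. -/
def firstVariation (γ X : ℤ → Fin m → ℝ) (n : ℤ) (u : Fin m → ℝ) : ℝ :=
  ∑ r ∈ range (m - 1), vol₂ γ n r (X (n + r)) (m - 1) u

/-- The bilinear expression in `X` and `Y` whose antisymmetrization, summed over a period, is
`-2 ω₁(X, Y)`. -/
def pairing (γ X Y : ℤ → Fin m → ℝ) (n : ℤ) : ℝ :=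
  firstVariation γ X (n + 1) (defect γ Y n)

theorem defect_mulVec (A : Matrix (Fin m) (Fin m) ℝ) (γ X : ℤ → Fin m → ℝ) (n : ℤ) :
    defect γ (fun k => A *ᵥ X k) n = A *ᵥ defect γ X n := by
  simp only [defect, mulVec_sub, mulVec_sum, mulVec_smul]

theorem IsTwisted.vol₂_add_period {N : ℕ} {T : SL(m, ℝ)} {γ : ℤ → Fin m → ℝ}
    (hγ : IsTwisted N T γ) (n : ℤ) (p : ℕ) (u : Fin m → ℝ) (q : ℕ) (w : Fin m → ℝ) :
    vol₂ γ (n + N) p (T.1 *ᵥ u) q (T.1 *ᵥ w) = vol₂ γ n p u q w := by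
  have hshift : (fun j : ℕ => γ (n + N + j)) = (T.1 *ᵥ ·) ∘ fun j : ℕ => γ (n + j) :=
    funext fun j => by simp [← hγ (n + j), add_right_comm]
  rw [vol₂, hshift, ← comp_update, ← comp_update]
  exact (vol_mulVec T.1 _).trans (by rw [T.2, one_mul, vol₂])

theorem IsTwisted.firstVariation_add_period {N : ℕ} {T : SL(m, ℝ)} {γ X : ℤ → Fin m → ℝ}
    (hγ : IsTwisted N T γ) (hX : IsTwisted N T X) (n : ℤ) (u : Fin m → ℝ) :
    firstVariation γ X (n + N) (T.1 *ᵥ u) = firstVariation γ X n u := by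
  refine sum_congr rfl fun r _ => ?_
  rw [add_right_comm, hX, hγ.vol₂_add_period]

variable [NeZero m]

theorem firstVariation_sub (γ X : ℤ → Fin m → ℝ) (n : ℤ) (u w : Fin m → ℝ) :
    firstVariation γ X n (u - w) = firstVariation γ X n u - firstVariation γ X n w := by
  have hadd (r : ℕ) (w' : Fin m → ℝ) := vol₂_add_right γ n r (X (n + r))
    (Nat.sub_one_lt (NeZero.ne m)) (u - w) w'
  simp only [firstVariation, ← sum_sub_distrib]
  refine sum_congr rfl fun r _ => eq_sub_of_add_eq ?_
  rw [← hadd r w, sub_add_cancel]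

theorem vertex_succ_last (γ : ℤ → Fin m → ℝ) (n : ℤ) : γ (n + 1 + (m - 1 : ℕ)) = γ (n + m) := by
  have := NeZero.pos m
  congr 1
  lia

theorem vol_update_zero_next (γ : ℤ → Fin m → ℝ) (n : ℤ) :
    vol (update (fun j => γ (n + j)) 0 (γ (n + m))) = (-1) ^ (m - 1) * arcLength γ (n + 1) := by
  have hrotate := vol_rotate (update (fun j : ℕ => γ (n + j)) 0 (γ (n + m)))
  have hshift : (fun j : ℕ => γ (n + (j + 1 : ℕ))) = fun j : ℕ => γ (n + 1 + j) := by
    funext j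
    congr 1
    lia
  simp only [update_self, ne_eq, Nat.add_eq_zero_iff, one_ne_zero, and_false, not_false_eq_true,
    update_of_ne, hshift] at hrotate
  rw [← vertex_succ_last γ n, update_eq_self (m - 1) fun j : ℕ => γ (n + 1 + j)] at hrotate
  rw [arcLength, hrotate, vertex_succ_last γ n, ← mul_assoc, ← mul_pow]
  simp

-- Both correction terms vanish on arc length polygons; they are kept because the identity is later
-- differentiated along tangent vectors.
theorem defect_self (γ : ℤ → Fin m → ℝ) (n : ℤ) :
    defect γ γ n = (1 - arcLength γ n) • γ (n + m) +
      ((-1) ^ (m - 1) * (arcLength γ (n + 1) - 1)) • γ n := by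
  have hcramer : ∑ l ∈ range m, vol (update (fun j => γ (n + j)) l (γ (n + m))) • γ (n + l) =
      arcLength γ n • γ (n + m) :=
    sum_vol_update_smul (fun j : ℕ => γ (n + j)) (γ (n + m))
  have hdiff : ∑ l ∈ range m, (vol (update (fun j => γ (n + j)) l (γ (n + m))) -
      invariant γ n l) • γ (n + l) = ((-1) ^ (m - 1) * (arcLength γ (n + 1) - 1)) • γ n := by
    rw [sum_eq_single 0 (fun l _ hl => by simp [invariant, hl])
      (fun h => (h (mem_range.2 (NeZero.pos m))).elim), vol_update_zero_next, invariant, if_pos rfl,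
      Nat.cast_zero, add_zero, mul_sub_one]
  simp only [sub_smul, sum_sub_distrib, hcramer] at hdiff
  rw [defect, ← hdiff]
  module

theorem vol₂_succ_last (γ : ℤ → Fin m → ℝ) (n : ℤ) (r : ℕ) (w u : Fin m → ℝ) :
    vol₂ γ (n + 1) r w (m - 1) u = (-1) ^ (m - 1) * vol₂ γ n 0 u (r + 1) w := by
  have hrotate := vol_rotate (update (update (fun j : ℕ => γ (n + j)) 0 u) (r + 1) w)
  have hshift : (fun j => update (update (fun j : ℕ => γ (n + j)) 0 u) (r + 1) w (j + 1)) =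
      update (fun j : ℕ => γ (n + 1 + j)) r w := by
    funext j
    by_cases hj : j = r
    · simp [hj]
    · simp [hj, add_assoc, add_comm (1 : ℤ)]
  rw [hshift] at hrotate
  simpa [vol₂] using hrotate

theorem vol₂_J (γ Y : ℤ → Fin m → ℝ) (n : ℤ) (r : ℕ) (w : Fin m → ℝ) :
    vol₂ γ n 0 (J γ Y n) (r + 1) w =
      vol₂ γ (n + 1) r w (m - 1) (∑ l ∈ range m, invariant γ n l • Y (n + l)) := by
  have hlast := vol₂_smul_right γ (n + 1) r w (Nat.sub_one_lt (NeZero.ne m)) ((-1) ^ (m - 1))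
    (∑ l ∈ range m, invariant γ n l • Y (n + l))
  rw [← J, vol₂_succ_last] at hlast
  exact mul_left_cancel₀ (pow_ne_zero _ (by norm_num)) hlast

theorem sum_vol₂_J (γ X Y : ℤ → Fin m → ℝ) (n : ℤ) :
    ∑ r ∈ Icc 1 (m - 1), vol₂ γ n 0 (J γ Y n) r (X (n + r)) =
      firstVariation γ X (n + 1) (Y (n + m)) - pairing γ X Y n := by
  rw [sum_Icc_one_eq_sum_range, pairing, ← firstVariation_sub, defect, sub_sub_cancel]
  refine sum_congr rfl fun r _ => ?_
  rw [vol₂_J, Nat.cast_add_one, add_right_comm, add_assoc]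

theorem omega₁_eq_sum_pairing {N : ℕ} {T : SL(m, ℝ)} {γ X Y : ℤ → Fin m → ℝ}
    (hγ : IsTwisted N T γ) (hX : IsTwisted N T X) (hY : IsTwisted N T Y) :
    omega₁ N γ X Y = (1 / 2) * ∑ n ∈ Icc (1 : ℤ) N, (pairing γ Y X n - pairing γ X Y n) := by
  let boundary (n : ℤ) : ℝ :=
    firstVariation γ X n (Y (n + m - 1)) - firstVariation γ Y n (X (n + m - 1))
  have hperiodic : Periodic boundary N := fun n => by
    have hindex : n + N + m - 1 = n + m - 1 + N := by ring
    simp only [boundary, hindex, hX _, hY _, hγ.firstVariation_add_period hX,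
      hγ.firstVariation_add_period hY]
  have hsum (X Y : ℤ → Fin m → ℝ) (n : ℤ) :
      ∑ r ∈ Icc 1 (m - 1), vol₂ γ n (r - 1) (X (n + r - 1)) (m - 1) (Y (n + m - 1)) =
        firstVariation γ X n (Y (n + m - 1)) := by
    rw [sum_Icc_one_eq_sum_range]
    refine sum_congr rfl fun r _ => ?_
    rw [Nat.add_sub_cancel, Nat.cast_add_one, ← add_assoc, add_sub_cancel_right]
  rw [omega₁, ← add_zero (∑ n ∈ Icc (1 : ℤ) N, (pairing γ Y X n - pairing γ X Y n)),
    ← sum_Icc_sub_of_periodic hperiodic, ← sum_add_distrib]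
  refine congrArg _ (sum_congr rfl fun n _ => ?_)
  have hindex : n + 1 + (m : ℤ) - 1 = n + m := by ring
  simp only [sum_add_distrib, sum_sub_distrib, sum_vol₂_J, hsum, boundary, hindex]
  ring

end Frames

section Motion

variable {m N : ℕ} {T : SL(m, ℝ)} {γ X : ℤ → Fin m → ℝ} {n : ℤ}

/-- The matrix `A_n(X)` taking `γ_{n+j}` to `X_{n+j}` for `0 ≤ j < m`, provided that the frame of
`γ` at `n` is invertible. -/
def motion (γ X : ℤ → Fin m → ℝ) (n : ℤ) : Matrix (Fin m) (Fin m) ℝ :=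
  frame X n * (frame γ n)⁻¹

theorem isUnit_frame (hn : arcLength γ n = 1) : IsUnit (frame γ n) :=
  (isUnit_iff_isUnit_det _).2 ((show (frame γ n).det = 1 from hn) ▸ isUnit_one)

theorem eq_of_mulVec_vertex_eq {A B : Matrix (Fin m) (Fin m) ℝ} (hn : IsUnit (frame γ n))
    (hAB : ∀ j < m, A *ᵥ γ (n + j) = B *ᵥ γ (n + j)) : A = B := by
  refine hn.mul_right_cancel ?_
  ext i j
  exact congrFun (hAB j j.2) i

theorem motion_mulVec (hn : IsUnit (frame γ n)) (X : ℤ → Fin m → ℝ) {j : ℕ} (hj : j < m) :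
    motion γ X n *ᵥ γ (n + j) = X (n + j) := by
  have hmotion : motion γ X n * frame γ n = frame X n :=
    nonsing_inv_mul_cancel_right _ _ ((isUnit_iff_isUnit_det _).1 hn)
  ext i
  exact congr_fun₂ hmotion i ⟨j, hj⟩

theorem IsTwisted.frame_add_period (hγ : IsTwisted N T γ) (n : ℤ) :
    frame γ (n + N) = T.1 * frame γ n := by
  simp only [frame, mul_columns, ← hγ _, add_right_comm]

theorem isUnit_specialLinearGroup (T : SL(m, ℝ)) : IsUnit T.1 :=
  (isUnit_iff_isUnit_det _).2 (by rw [T.2]; exact isUnit_one)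

theorem IsTwisted.semiconjBy_motion (hγ : IsTwisted N T γ) (hX : IsTwisted N T X) (n : ℤ) :
    SemiconjBy T.1 (motion γ X n) (motion γ X (n + N)) := by
  have hT : T.1⁻¹ * T.1 = 1 :=
    nonsing_inv_mul _ ((isUnit_iff_isUnit_det _).1 (isUnit_specialLinearGroup T))
  rw [SemiconjBy, motion, motion, hγ.frame_add_period, hX.frame_add_period, Matrix.mul_inv_rev]
  simp only [Matrix.mul_assoc, hT, Matrix.mul_one]

theorem IsTwisted.periodic_trace_motion_mul_mul {Y Z : ℤ → Fin m → ℝ} (hγ : IsTwisted N T γ)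
    (hX : IsTwisted N T X) (hY : IsTwisted N T Y) (hZ : IsTwisted N T Z) :
    Periodic (fun n => (motion γ X n * motion γ Y n * motion γ Z n).trace) N := fun n =>
  trace_eq_of_semiconjBy (isUnit_specialLinearGroup T)
    (((hγ.semiconjBy_motion hX n).mul_right (hγ.semiconjBy_motion hY n)).mul_right
      (hγ.semiconjBy_motion hZ n))

theorem IsTwisted.mulVec (hγ : IsTwisted N T γ) {A : Matrix (Fin m) (Fin m) ℝ}
    (hA : Commute A T.1) : IsTwisted N T fun k => A *ᵥ γ k := fun n => by
  simp only [hγ n, mulVec_mulVec, hA.eq]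

variable [NeZero m]

/-- The covector of the linear form `u ↦ |γ_n, …, γ_{n+m-2}, u|`. -/
def covector (γ : ℤ → Fin m → ℝ) (n : ℤ) : Fin m → ℝ :=
  (frame γ n).adjugate ⟨m - 1, Nat.sub_one_lt (NeZero.ne m)⟩

theorem covector_dotProduct (γ : ℤ → Fin m → ℝ) (n : ℤ) (u : Fin m → ℝ) :
    covector γ n ⬝ᵥ u = vol (update (fun j => γ (n + j)) (m - 1) u) :=
  (vol_update (fun j : ℕ => γ (n + j)) ⟨m - 1, Nat.sub_one_lt (NeZero.ne m)⟩ u).symm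

theorem covector_dotProduct_vertex (γ : ℤ → Fin m → ℝ) (n : ℤ) {j : ℕ} (hj : j + 1 < m) :
    covector γ n ⬝ᵥ γ (n + j) = 0 := by
  rw [covector_dotProduct]
  exact vol_update_eq_zero (fun j : ℕ => γ (n + j)) (by lia) (by lia) (by lia)

theorem covector_succ_dotProduct_next (γ : ℤ → Fin m → ℝ) (n : ℤ) :
    covector γ (n + 1) ⬝ᵥ γ (n + m) = arcLength γ (n + 1) := by
  rw [covector_dotProduct, ← vertex_succ_last γ n,
    update_eq_self (m - 1) fun j : ℕ => γ (n + 1 + j), arcLength]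

theorem firstVariation_add_covector_dotProduct {A : Matrix (Fin m) (Fin m) ℝ}
    (hA : ∀ j, j + 1 < m → A *ᵥ γ (n + j) = X (n + j)) (u : Fin m → ℝ) :
    firstVariation γ X n u + covector γ n ⬝ᵥ A *ᵥ u = A.trace * (covector γ n ⬝ᵥ u) := by
  have htrace := sum_vol_update_mulVec A (update (fun j : ℕ => γ (n + j)) (m - 1) u)
  rw [sum_range_eq_sum_range_pred_add, update_self, update_idem] at htrace
  rw [covector_dotProduct, covector_dotProduct, ← htrace, firstVariation]
  refine congrArg₂ _ (sum_congr rfl fun r hr => ?_) rfl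
  have hr : r < m - 1 := mem_range.1 hr
  rw [update_of_ne hr.ne, hA r (by lia), vol₂, update_comm hr.ne]

theorem defect_self_eq_zero (h : ∀ n, arcLength γ n = 1) (n : ℤ) : defect γ γ n = 0 := by
  simp [defect_self, h]

theorem motion_mulVec_next (h : ∀ n, arcLength γ n = 1) (X : ℤ → Fin m → ℝ) (n : ℤ) :
    motion γ X n *ᵥ γ (n + m) = X (n + m) - defect γ X n := by
  rw [sub_eq_zero.1 (defect_self_eq_zero h n), defect, sub_sub_cancel, mulVec_sum]
  refine sum_congr rfl fun l hl => ?_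
  rw [mulVec_smul, motion_mulVec (isUnit_frame (h n)) X (mem_range.1 hl)]

theorem motion_succ (h : ∀ n, arcLength γ n = 1) (X : ℤ → Fin m → ℝ) (n : ℤ) :
    motion γ X (n + 1) = motion γ X n + vecMulVec (defect γ X n) (covector γ (n + 1)) := by
  have hunit := fun k => isUnit_frame (h k)
  refine eq_of_mulVec_vertex_eq (hunit (n + 1)) fun j hj => ?_
  rw [motion_mulVec (hunit _) X hj, add_mulVec, vecMulVec_mulVec, op_smul_eq_smul]
  obtain hj | rfl : j + 1 < m ∨ j = m - 1 := by lia
  · have hindex : n + 1 + (j : ℤ) = n + (j + 1 : ℕ) := by lia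
    rw [covector_dotProduct_vertex γ _ hj, zero_smul, add_zero, hindex,
      motion_mulVec (hunit n) X hj]
  · rw [vertex_succ_last γ n, vertex_succ_last X n, covector_succ_dotProduct_next, h, one_smul,
      motion_mulVec_next h, sub_add_cancel]

end Motion

section Kernel

variable {m N : ℕ} [NeZero m] {T : SL(m, ℝ)} {γ Y : ℤ → Fin m → ℝ}

theorem omega₁_mulVec_eq_zero (h : ∀ n, arcLength γ n = 1) (hγ : IsTwisted N T γ)
    (hY : IsTwisted N T Y) {A : Matrix (Fin m) (Fin m) ℝ} (hA : A.trace = 0)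
    (hAT : Commute A T.1) : omega₁ N γ (fun k => A *ᵥ γ k) Y = 0 := by
  have hperiodic : Periodic (fun n => (A * motion γ Y n).trace) N := fun n =>
    trace_eq_of_semiconjBy (isUnit_specialLinearGroup T)
      (SemiconjBy.mul_right hAT.symm (hγ.semiconjBy_motion hY n))
  rw [omega₁_eq_sum_pairing hγ (hγ.mulVec hAT) hY, ← mul_zero (1 / 2 : ℝ),
    ← sum_Icc_sub_of_periodic hperiodic]
  refine congrArg _ (sum_congr rfl fun n _ => ?_)
  have hleft : pairing γ Y (fun k => A *ᵥ γ k) n = 0 := by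
    rw [pairing, defect_mulVec, defect_self_eq_zero h, mulVec_zero, ← sub_self (0 : Fin m → ℝ),
      firstVariation_sub, sub_self]
  have hright := firstVariation_add_covector_dotProduct (n := n + 1)
    (X := fun k => A *ᵥ γ k) (fun _ _ => rfl) (defect γ Y n)
  rw [hA, zero_mul, ← trace_mul_vecMulVec] at hright
  rw [hleft, pairing, motion_succ h, Matrix.mul_add, trace_add]
  linarith

end Kernel

section Derivatives

variable {m : ℕ} {γ X Y Z : ℤ → Fin m → ℝ}

/-- `X` preserves the arc lengths of `γ` to first order: the tangency condition, for sequences. -/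
def PreservesArcLength (γ X : ℤ → Fin m → ℝ) : Prop :=
  ∀ n, HasDerivAt (fun t : ℝ => arcLength (γ + t • X) n) 0 0

/-- The derivative of `a_n^r` along `X`. -/
def invariantDeriv (γ X : ℤ → Fin m → ℝ) (n : ℤ) (r : ℕ) : ℝ :=
  deriv (fun t : ℝ => invariant (γ + t • X) n r) 0

/-- The second derivative of `γ ↦ |γ_n, …, γ_{n+m-2}, u|` along `X` and `Y`. -/
def secondVariation (γ X Y : ℤ → Fin m → ℝ) (n : ℤ) (u : Fin m → ℝ) : ℝ :=
  ∑ r ∈ range (m - 1), ∑ s ∈ range (m - 1) with s ≠ r,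
    vol (update (update (update (fun j => γ (n + j)) r (Y (n + r))) s (X (n + s))) (m - 1) u)

theorem hasDerivAt_add_smul {𝕜 E : Type*} [NontriviallyNormedField 𝕜] [NormedAddCommGroup E]
    [NormedSpace 𝕜 E] (a b : E) (t : 𝕜) : HasDerivAt (fun s : 𝕜 => a + s • b) b t := by
  simpa using ((hasDerivAt_id t).smul_const b).const_add a

theorem hasDerivAt_update {𝕜 ι E : Type*} [NontriviallyNormedField 𝕜] [DecidableEq ι]
    [NormedAddCommGroup E] [NormedSpace 𝕜 E] {v : 𝕜 → ι → E} {v' : ι → E} {t : 𝕜}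
    (hv : ∀ j, HasDerivAt (fun s => v s j) (v' j) t) (p : ι) {u : 𝕜 → E} {u' : E}
    (hu : HasDerivAt u u' t) (j : ι) :
    HasDerivAt (fun s => update (v s) p (u s) j) (update v' p u' j) t := by
  obtain rfl | hj := eq_or_ne j p
  · simpa using hu
  · simpa [hj] using hv j

theorem hasDerivAt_arcLength {n : ℤ} {A : Matrix (Fin m) (Fin m) ℝ}
    (hA : ∀ j < m, A *ᵥ γ (n + j) = X (n + j)) :
    HasDerivAt (fun t : ℝ => arcLength (γ + t • X) n) (A.trace * arcLength γ n) 0 := by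
  have hvol := hasDerivAt_vol fun j : ℕ => hasDerivAt_add_smul (γ (n + j)) (X (n + j)) 0
  refine hvol.congr_deriv ?_
  rw [arcLength, ← sum_vol_update_mulVec]
  refine sum_congr rfl fun j hj => ?_
  simp only [hA j (mem_range.1 hj), zero_smul, add_zero]

theorem preservesArcLength_mulVec (γ : ℤ → Fin m → ℝ) {A : Matrix (Fin m) (Fin m) ℝ}
    (hA : A.trace = 0) : PreservesArcLength γ fun k => A *ᵥ γ k := fun n => by
  simpa [hA] using hasDerivAt_arcLength (γ := γ) (n := n) (A := A) fun _ _ => rfl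

theorem PreservesArcLength.trace_motion_eq_zero (hX : PreservesArcLength γ X) {n : ℤ}
    (hn : arcLength γ n = 1) : (motion γ X n).trace = 0 := by
  have htrace := hasDerivAt_arcLength fun j hj => motion_mulVec (isUnit_frame hn) X (j := j) hj
  rw [hn, mul_one] at htrace
  exact htrace.unique (hX n)

theorem hasDerivAt_invariant (γ X : ℤ → Fin m → ℝ) (n : ℤ) (r : ℕ) :
    HasDerivAt (fun t : ℝ => invariant (γ + t • X) n r) (invariantDeriv γ X n r) 0 := by
  refine DifferentiableAt.hasDerivAt ?_
  obtain rfl | hr := eq_or_ne r 0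
  · simp [invariant]
  · have hvertex (k : ℤ) : ContDiff ℝ ∞ fun t : ℝ => (γ + t • X) k := by
      simp only [Pi.add_apply, Pi.smul_apply]
      fun_prop
    simp only [invariant, hr, if_false]
    exact (contDiff_vol (contDiff_update (fun j => hvertex _) r (hvertex _))).differentiable
      (by simp) 0

theorem invariantDeriv_zero (γ X : ℤ → Fin m → ℝ) (n : ℤ) : invariantDeriv γ X n 0 = 0 := by
  simp [invariantDeriv, invariant]

theorem hasDerivAt_defect {Z : ℝ → ℤ → Fin m → ℝ} {Z' : ℤ → Fin m → ℝ}
    (hZ : ∀ k, HasDerivAt (fun t => Z t k) (Z' k) 0) (γ X : ℤ → Fin m → ℝ) (n : ℤ) :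
    HasDerivAt (fun t : ℝ => defect (γ + t • X) (Z t) n)
      (defect γ Z' n - ∑ l ∈ range m, invariantDeriv γ X n l • Z 0 (n + l)) 0 := by
  have hsum := HasDerivAt.fun_sum (u := range m) fun l _ =>
    (hasDerivAt_invariant γ X n l).smul (hZ (n + l))
  refine ((hZ (n + m)).sub hsum).congr_deriv ?_
  rw [sum_add_distrib, ← sub_sub]
  simp [defect]

theorem secondVariation_comm (γ X Y : ℤ → Fin m → ℝ) (n : ℤ) (u : Fin m → ℝ) :
    secondVariation γ X Y n u = secondVariation γ Y X n u := by
  rw [secondVariation, sum_comm' (t' := range (m - 1)) (s' := fun s => {r ∈ range (m - 1) | r ≠ s})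
    fun r s => by simp only [mem_filter]; tauto]
  refine sum_congr rfl fun s _ => sum_congr rfl fun r hr => ?_
  rw [update_comm (mem_filter.1 hr).2]

theorem IsTwisted.add_smul {N : ℕ} {T : SL(m, ℝ)} (hγ : IsTwisted N T γ) (hX : IsTwisted N T X)
    (t : ℝ) : IsTwisted N T (γ + t • X) := fun n => by
  simp only [Pi.add_apply, Pi.smul_apply, hγ n, hX n, mulVec_add, mulVec_smul]

variable [NeZero m]

theorem hasDerivAt_firstVariation (γ X Y : ℤ → Fin m → ℝ) (n : ℤ) {u : ℝ → Fin m → ℝ}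
    {u' : Fin m → ℝ} (hu : HasDerivAt u u' 0) :
    HasDerivAt (fun t : ℝ => firstVariation (γ + t • X) Y n (u t))
      (secondVariation γ X Y n (u 0) + firstVariation γ Y n u') 0 := by
  rw [secondVariation, firstVariation, ← sum_add_distrib]
  refine HasDerivAt.fun_sum fun r hr => ?_
  have hvol := hasDerivAt_vol <| hasDerivAt_update (hasDerivAt_update
    (fun j : ℕ => hasDerivAt_add_smul (γ (n + j)) (X (n + j)) 0) r
    (hasDerivAt_const (0 : ℝ) (Y (n + r)))) (m - 1) hu
  refine hvol.congr_deriv ?_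
  rw [sum_range_eq_sum_range_pred_add, sum_filter]
  simp only [zero_smul, add_zero, update_self, update_idem]
  refine congrArg₂ _ (sum_congr rfl fun s hs => ?_) rfl
  have hs : s < m - 1 := mem_range.1 hs
  obtain rfl | hsr := eq_or_ne s r
  · have hzero := vol_update_smul (update (update (fun j => γ (n + j)) s (Y (n + s))) (m - 1) (u 0))
      (show s < m by lia) 0 0
    simpa [hs.ne] using hzero
  · rw [if_pos hsr, update_of_ne hs.ne, update_of_ne hsr, update_comm hs.ne]

theorem PreservesArcLength.defect_eq_sum (hX : PreservesArcLength γ X)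
    (h : ∀ n, arcLength γ n = 1) (n : ℤ) :
    defect γ X n = ∑ l ∈ range m, invariantDeriv γ X n l • γ (n + l) := by
  have hvertex (k : ℤ) := hasDerivAt_add_smul (γ k) (X k) (0 : ℝ)
  have hsum := hasDerivAt_defect hvertex γ X n
  have hzero := (((hX n).const_sub 1).smul (hvertex (n + m))).add
    ((((hX (n + 1)).sub_const 1).const_mul ((-1) ^ (m - 1))).smul (hvertex n))
  have hunique := hsum.unique (hzero.congr_of_eventuallyEq
    (.of_forall fun t => defect_self (γ + t • X) n))
  simp only [zero_smul, add_zero, h, sub_self, neg_zero, mul_zero] at hunique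
  exact sub_eq_zero.1 hunique

theorem PreservesArcLength.covector_dotProduct_defect (hX : PreservesArcLength γ X)
    (h : ∀ n, arcLength γ n = 1) (n : ℤ) : covector γ (n + 1) ⬝ᵥ defect γ X n = 0 := by
  rw [hX.defect_eq_sum h, dotProduct_sum]
  refine sum_eq_zero fun l hl => ?_
  cases l with
  | zero => rw [invariantDeriv_zero, zero_smul, dotProduct_zero]
  | succ j =>
    have hindex : n + ((j + 1 : ℕ) : ℤ) = n + 1 + j := by lia
    rw [dotProduct_smul, hindex, covector_dotProduct_vertex γ _ (mem_range.1 hl), smul_zero]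

theorem PreservesArcLength.hasDerivAt_defect_const (hX : PreservesArcLength γ X)
    (h : ∀ n, arcLength γ n = 1) (Z : ℤ → Fin m → ℝ) (n : ℤ) :
    HasDerivAt (fun t : ℝ => defect (γ + t • X) Z n) (-(motion γ Z n *ᵥ defect γ X n)) 0 := by
  have hdefect := hasDerivAt_defect (fun k => hasDerivAt_const (0 : ℝ) (Z k)) γ X n
  refine hdefect.congr_deriv ?_
  have hzero : defect γ (fun _ => 0) n = 0 := by simp [defect]
  rw [hzero, zero_sub, hX.defect_eq_sum h, mulVec_sum]
  refine congrArg _ (sum_congr rfl fun l hl => ?_)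
  rw [mulVec_smul, motion_mulVec (isUnit_frame (h n)) Z (mem_range.1 hl)]

/-- The derivative along `X` of `γ ↦ pairing γ Y Z n`, for arc length preserving `X` and `Y`. -/
def pairingDeriv (γ X Y Z : ℤ → Fin m → ℝ) (n : ℤ) : ℝ :=
  secondVariation γ X Y (n + 1) (defect γ Z n) +
    (motion γ Y n * motion γ Z n * vecMulVec (defect γ X n) (covector γ (n + 1))).trace

theorem PreservesArcLength.hasDerivAt_pairing (hX : PreservesArcLength γ X)
    (hY : PreservesArcLength γ Y) (h : ∀ n, arcLength γ n = 1) (Z : ℤ → Fin m → ℝ) (n : ℤ) :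
    HasDerivAt (fun t : ℝ => pairing (γ + t • X) Y Z n) (pairingDeriv γ X Y Z n) 0 := by
  have hvariation := hasDerivAt_firstVariation γ X Y (n + 1) (hX.hasDerivAt_defect_const h Z n)
  refine hvariation.congr_deriv ?_
  have hmotion (j : ℕ) (hj : j + 1 < m) :
      motion γ Y n *ᵥ γ (n + 1 + j) = Y (n + 1 + j) := by
    have hindex : n + 1 + (j : ℤ) = n + (j + 1 : ℕ) := by lia
    rw [hindex, motion_mulVec (isUnit_frame (h n)) Y hj]
  have hcovector := firstVariation_add_covector_dotProduct hmotion
    (-(motion γ Z n *ᵥ defect γ X n))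
  rw [hY.trace_motion_eq_zero (h n), zero_mul, mulVec_neg, dotProduct_neg, mulVec_mulVec,
    ← sub_eq_add_neg, sub_eq_zero, ← trace_mul_vecMulVec] at hcovector
  simp only [hcovector, zero_smul, add_zero, pairingDeriv]

theorem pairingDeriv_alternating_sum (h : ∀ n, arcLength γ n = 1) (hX : PreservesArcLength γ X)
    (hY : PreservesArcLength γ Y) (hZ : PreservesArcLength γ Z) (n : ℤ) :
    (pairingDeriv γ X Z Y n - pairingDeriv γ X Y Z n) -
        (pairingDeriv γ Y Z X n - pairingDeriv γ Y X Z n) +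
        (pairingDeriv γ Z Y X n - pairingDeriv γ Z X Y n) =
      ((motion γ X (n + 1) * motion γ Z (n + 1) * motion γ Y (n + 1)).trace -
          (motion γ X (n + 1) * motion γ Y (n + 1) * motion γ Z (n + 1)).trace) -
        ((motion γ X n * motion γ Z n * motion γ Y n).trace -
          (motion γ X n * motion γ Y n * motion γ Z n).trace) := by
  have hzero (V : ℤ → Fin m → ℝ) {W : ℤ → Fin m → ℝ} (hW : PreservesArcLength γ W) :
      vecMulVec (defect γ V n) (covector γ (n + 1)) *
        vecMulVec (defect γ W n) (covector γ (n + 1)) = 0 := by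
    rw [vecMulVec_mul_vecMulVec, hW.covector_dotProduct_defect h, zero_smul, vecMulVec_zero]
  have hXYZ := trace_mul_mul_add_sub_of_mul_eq_zero (x := motion γ X n) (y := motion γ Y n)
    (z := motion γ Z n) (hzero X hY) (hzero Y hZ) (hzero Z hX)
  have hXZY := trace_mul_mul_add_sub_of_mul_eq_zero (x := motion γ X n) (y := motion γ Z n)
    (z := motion γ Y n) (hzero X hZ) (hzero Z hY) (hzero Y hX)
  simp only [← motion_succ h] at hXYZ hXZY
  simp only [pairingDeriv, secondVariation_comm γ Z X, secondVariation_comm γ Z Y,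
    secondVariation_comm γ Y X]
  linarith

theorem hasDerivAt_omega₁ {N : ℕ} {T : SL(m, ℝ)} (h : ∀ n, arcLength γ n = 1)
    (hγ : IsTwisted N T γ) (hX : IsTwisted N T X) (hY : IsTwisted N T Y) (hZ : IsTwisted N T Z)
    (hX' : PreservesArcLength γ X) (hY' : PreservesArcLength γ Y) (hZ' : PreservesArcLength γ Z) :
    HasDerivAt (fun t : ℝ => omega₁ N (γ + t • X) Y Z) ((1 / 2) * ∑ n ∈ Icc (1 : ℤ) N,
      (pairingDeriv γ X Z Y n - pairingDeriv γ X Y Z n)) 0 := by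
  simp only [fun t => omega₁_eq_sum_pairing (hγ.add_smul hX t) hY hZ]
  exact (HasDerivAt.fun_sum fun n _ =>
    (hX'.hasDerivAt_pairing hZ' h Y n).sub (hX'.hasDerivAt_pairing hY' h Z n)).const_mul _

end Derivatives

theorem extDeriv_apply_vecCons₃ {𝕜 E F : Type*} [NontriviallyNormedField 𝕜] [NormedAddCommGroup E]
    [NormedSpace 𝕜 E] [NormedAddCommGroup F] [NormedSpace 𝕜 F] {η : E → E [⋀^Fin 2]→L[𝕜] F} {x : E}
    (hη : DifferentiableAt 𝕜 η x) (X Y Z : E) :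
    extDeriv η x ![X, Y, Z] = fderiv 𝕜 (fun y => η y ![Y, Z]) x X -
      fderiv 𝕜 (fun y => η y ![X, Z]) x Y + fderiv 𝕜 (fun y => η y ![X, Y]) x Z := by
  have hX : (0 : Fin 3).removeNth ![X, Y, Z] = ![Y, Z] := by ext i; fin_cases i <;> rfl
  have hY : (1 : Fin 3).removeNth ![X, Y, Z] = ![X, Z] := by ext i; fin_cases i <;> rfl
  have hZ : (2 : Fin 3).removeNth ![X, Y, Z] = ![X, Y] := by ext i; fin_cases i <;> rfl
  rw [extDeriv_apply hη, Fin.sum_univ_three, hX, hY, hZ]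
  simp [sub_eq_add_neg]

section Coordinates

variable {m N : ℕ} [NeZero N] {T : SL(m, ℝ)} {x X Y Z : Vertices m N}

theorem polygon_add_smul (T : SL(m, ℝ)) (x X : Vertices m N) (t : ℝ) :
    polygon T (x + t • X) = polygon T x + t • polygon T X :=
  funext fun n => by rw [polygon_add, polygon_smul, Pi.add_apply, Pi.smul_apply]

theorem mem_tangent_iff :
    X ∈ tangent T x ↔ PreservesArcLength (polygon T x) (polygon T X) := by
  have hderiv (n : ℤ) : HasDerivAt (fun t : ℝ => arcLength (polygon T x + t • polygon T X) n)
      (fderiv ℝ (fun y : Vertices m N => arcLength (polygon T y) n) x X) 0 := by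
    have hsmooth : ContDiff ℝ ∞ fun y : Vertices m N => arcLength (polygon T y) n :=
      contDiff_vol fun j => contDiff_polygon T (n + j)
    simp only [← polygon_add_smul]
    exact (hsmooth.differentiable (by simp) x).hasFDerivAt.hasLineDerivAt X
  exact ⟨fun h n => h n ▸ hderiv n, fun h n => (hderiv n).unique (h n)⟩

theorem exists_mem_tangent_omega₁Form_eq_zero (hm : 2 ≤ m)
    (hx : polygon T x ∈ arcLengthPolygons N T) :
    ∃ X ∈ tangent T x, X ≠ 0 ∧ ∀ Y, omega₁Form T x ![X, Y] = 0 := by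
  have : NeZero m := ⟨by lia⟩
  have : Nontrivial (Fin m) := Fin.nontrivial_iff_two_le.2 hm
  obtain ⟨A, hA_ne, hA, hAT⟩ := exists_ne_zero_trace_eq_zero_commute T.1
  obtain ⟨X, hX⟩ : ∃ X : Vertices m N, (fun k => A *ᵥ polygon T x k) = polygon T X :=
    ⟨_, (hx.1.mulVec hAT).eq_polygon⟩
  refine ⟨X, mem_tangent_iff.2 (hX ▸ preservesArcLength_mulVec _ hA), ?_, fun Y => ?_⟩
  · rintro rfl
    refine hA_ne (eq_of_mulVec_vertex_eq (isUnit_frame (hx.2 0)) fun j _ => ?_)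
    simpa [polygon] using congrFun hX (0 + j)
  · change omega₁ N (polygon T x) (polygon T X) (polygon T Y) = 0
    exact hX ▸ omega₁_mulVec_eq_zero hx.2 hx.1 (isTwisted_polygon T Y) hA hAT

variable [NeZero m]

theorem fderiv_omega₁Form (hx : polygon T x ∈ arcLengthPolygons N T) (hX : X ∈ tangent T x)
    (hY : Y ∈ tangent T x) (hZ : Z ∈ tangent T x) :
    fderiv ℝ (fun y => omega₁Form T y ![Y, Z]) x X = (1 / 2) * ∑ n ∈ Icc (1 : ℤ) N,
      (pairingDeriv (polygon T x) (polygon T X) (polygon T Z) (polygon T Y) n -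
        pairingDeriv (polygon T x) (polygon T X) (polygon T Y) (polygon T Z) n) := by
  have hsmooth : ContDiff ℝ ∞ fun y => omega₁Form T y ![Y, Z] :=
    contDiff_omega₁ N (contDiff_polygon T) (fun _ => contDiff_const) fun _ => contDiff_const
  have hline := (hsmooth.differentiable (by simp) x).hasFDerivAt.hasLineDerivAt X
  have homega := hasDerivAt_omega₁ hx.2 hx.1 (isTwisted_polygon T X) (isTwisted_polygon T Y)
    (isTwisted_polygon T Z) (mem_tangent_iff.1 hX) (mem_tangent_iff.1 hY) (mem_tangent_iff.1 hZ)
  simp only [← polygon_add_smul] at homega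
  exact hline.unique homega

theorem extDeriv_omega₁Form_eq_zero (hx : polygon T x ∈ arcLengthPolygons N T)
    (hX : X ∈ tangent T x) (hY : Y ∈ tangent T x) (hZ : Z ∈ tangent T x) :
    extDeriv (omega₁Form T) x ![X, Y, Z] = 0 := by
  have hperiodic (U V W : Vertices m N) := hx.1.periodic_trace_motion_mul_mul
    (isTwisted_polygon T U) (isTwisted_polygon T V) (isTwisted_polygon T W)
  rw [extDeriv_apply_vecCons₃ ((contDiff_omega₁Form T).differentiable (by simp) x),
    fderiv_omega₁Form hx hX hY hZ, fderiv_omega₁Form hx hY hX hZ, fderiv_omega₁Form hx hZ hX hY,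
    ← mul_sub, ← mul_add, ← sum_sub_distrib, ← sum_add_distrib]
  simp only [pairingDeriv_alternating_sum hx.2 (mem_tangent_iff.1 hX) (mem_tangent_iff.1 hY)
    (mem_tangent_iff.1 hZ)]
  exact mul_eq_zero_of_right _
    (sum_Icc_sub_of_periodic ((hperiodic X Z Y).sub (hperiodic X Y Z)))

end Coordinates

end CentroAffine

end

open CentroAffine in
theorem mainTheorem4_general (m N : ℕ) [NeZero N] (hm : 2 ≤ m)
    (T : Matrix.SpecialLinearGroup (Fin m) ℝ) :
    (∀ x : Vertices m N, polygon T x ∈ arcLengthPolygons N T →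
      ∀ X ∈ tangent T x, ∀ Y ∈ tangent T x, ∀ Z ∈ tangent T x,
        extDeriv (omega₁Form T) x ![X, Y, Z] = 0) ∧
    (∀ x : Vertices m N, polygon T x ∈ arcLengthPolygons N T →
      ∃ X ∈ tangent T x, X ≠ 0 ∧ ∀ Y, omega₁Form T x ![X, Y] = 0) := by
  have : NeZero m := ⟨by lia⟩
  exact ⟨fun _ hx _ hX _ hY _ hZ => extDeriv_omega₁Form_eq_zero hx hX hY hZ,
    fun _ hx => exists_mem_tangent_omega₁Form_eq_zero hm hx⟩

theorem mainTheorem4 (m N : ℕ) [NeZero N] (hm : 2 ≤ m) (hNm : Nat.Coprime N m)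
    (T : Matrix.SpecialLinearGroup (Fin m) ℝ) :
    -- `ω₁` is closed on the manifold of arc length parametrized polygons
    (∀ x : CentroAffine.Vertices m N,
      CentroAffine.polygon T x ∈ CentroAffine.arcLengthPolygons N T →
      ∀ X ∈ CentroAffine.tangent T x, ∀ Y ∈ CentroAffine.tangent T x,
        ∀ Z ∈ CentroAffine.tangent T x,
          extDeriv (CentroAffine.omega₁Form T) x ![X, Y, Z] = 0) ∧
    -- and its kernel is non-trivial at each point
    (∀ x : CentroAffine.Vertices m N,
      CentroAffine.polygon T x ∈ CentroAffine.arcLengthPolygons N T →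
      ∃ X ∈ CentroAffine.tangent T x, X ≠ 0 ∧
        ∀ Y ∈ CentroAffine.tangent T x, CentroAffine.omega₁Form T x ![X, Y] = 0) := by
  obtain ⟨hclosed, hker⟩ := mainTheorem4_general m N hm T
  exact ⟨hclosed, fun x hx => (hker x hx).imp fun _ ⟨hX, hX0, hω⟩ => ⟨hX, hX0, fun Y _ => hω Y⟩⟩
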